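/- **Setting.** Let $T>0$, $n\ge 1$, let $\pi$ be a positive $C^1$ probability density on $\mathbb R^d$, and let $s^\theta:\mathbb R^d\to\mathbb R^d$, $\theta\in\mathbb R^N$, be a parametric family of vector fields (the neural network), jointly differentiable in $(\theta,x)$. For probability densities $\rho$ and vector fields $\sigma$ put $$\mathrm{KL}(\rho\|\pi)=\mathbb E_\rho\log\tfrac{\rho}{\pi},\qquad F(\rho\|\pi)=\mathbb E_\rho\big\|\nabla\log\tfrac{\rho}{\pi}\big\|^2,\qquad L(\sigma,\rho)=\mathbb E_\rho\|\sigma-\nabla\log\rho\|^2 .$$ **Dynamics.** On a probability space let $X_t=(X^1_t,\dots,X^n_t)$ (particles in $\mathbb R^d$) and $\Theta_t\in\mathbb R^N$ (weights) be random processes, $0\le t\le T$, such that every $X^i_t$ has Lebesgue density $f_t$, the initial particles $X^1_0,\dots,X^n_0$ are independent, and almost surely, for all $t\in[0,T]$, with $s_t:=s^{\Theta_t}$, $$\frac{dX^i_t}{dt}=\nabla\log\pi(X^i_t)-s_t(X^i_t),\qquad \frac{d\Theta_t}{dt}=-\eta(t)\,\nabla_{\Theta}L^n(s^{\Theta},f_t)\Big|_{\Theta=\Theta_t},\qquad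 L^n(\sigma,f_t):=\frac1n\sum_{i=1}^n\|\sigma(X^i_t)-\nabla\log f_t(X^i_t)\|^2 .$$ (Time derivatives on $[0,T]$ are one-sided at the endpoints.) **Sufficient training.** Almost surely, for all $t\in[0,T]$: the neural tangent kernel $H^{i,j}_{\alpha,\beta}(t)=\sum_{k=1}^N\partial_{\theta_k}s_t^\alpha(X^i_t)\,\partial_{\theta_k}s_t^\beta(X^j_t)$, an $nd\times nd$ matrix, satisfies $\langle v,H(t)v\rangle\ge\lambda(t)\|v\|^2$ for all $v$, with some $\lambda(t)>0$; and $\eta(t)\ge 0$ and $$\eta(t)\ \ge\ \frac{n}{\lambda(t)}\,\frac{d}{d\tau}\Big|_{\tau=t}\log L^n(s_t,f_\tau),$$ where the weights are frozen at time $t$ while the density and the particles evolve, and the last inequality is required only at times when $L^n(s_t,f_t)>0$. ($\eta$ and $\lambda$ may depend on the realization.) **Regularity.** $f_t(x)$ is positive and jointly $C^2$ on $[0,T]\times\mathbb R^d$; $\mathrm{KL}(f_0\|\pi)<\infty$; $F(f_t\|\pi)<\infty$ for all $t\in[0,T]$; and there is an integrable $g$ on $\mathbb R^d$ with $|\partial_tf_t(x)|\,\big(1+|\log\frac{f_t(x)}{\pi(x)}|\big)\le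 g(x)$ for all $t\in[0,T]$ and all $x$. **Theorem.** Let $\varepsilon:=\inf_{0\le t\le T}F(f_t\|\pi)$. Suppose that almost surely $L^n(s_0,f_0)\le\frac14\varepsilon$, and that almost surely, for all $t\in[0,T]$, $L(s_t,f_t)<\infty$ and $|L^n(s_t,f_t)-L(s_t,f_t)|\le\frac14\varepsilon$. Then on $[0,T]$ the relative entropy $\mathrm{KL}(f_t\|\pi)$ is finite and differentiable in $t$, and $$-\frac{d}{dt}\mathrm{KL}(f_t\|\pi)\ \ge\ \frac14F(f_t\|\pi).$$ If moreover $\pi$ satisfies the log-Sobolev inequality with constant $\alpha>0$, i.e. $\mathrm{KL}(\rho\|\pi)\le\alpha F(\rho\|\pi)$ for all positive $C^1$ probability densities $\rho$ with $F(\rho\|\pi)<\infty$, then for all $t\in[0,T]$ $$\mathrm{KL}(f_t\|\pi)\le \mathrm{KL}(f_0\|\pi)\,e^{-t/(4\alpha)} .$$ -/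

import Mathlib

open MeasureTheory ProbabilityTheory Set
open scoped InformationTheory

noncomputable section

namespace SBTM

/-- State space `ℝ^d` of a particle, with the Euclidean norm. -/
abbrev State (d : ℕ) := EuclideanSpace ℝ (Fin d)

/-- Parameter space `ℝ^N` of the network weights, with the Euclidean norm. -/
abbrev Weights (N : ℕ) := EuclideanSpace ℝ (Fin N)

/-- The measure on `ℝ^d` with Lebesgue density `ρ`. -/
def densityMeasure {d : ℕ} (ρ : State d → ℝ) : Measure (State d) :=
  volume.withDensity (fun x => ENNReal.ofReal (ρ x))

/-- The score `∇ log ρ`. -/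
def score {d : ℕ} (ρ : State d → ℝ) (x : State d) : State d :=
  gradient (fun y => Real.log (ρ y)) x

/-- Relative entropy `KL(ρ ‖ π) = E_ρ log (ρ / π)` of two densities, with values in `[0, ∞]`. -/
def relEntropy {d : ℕ} (ρ π : State d → ℝ) : ENNReal :=
  InformationTheory.klDiv (densityMeasure ρ) (densityMeasure π)

/-- The integrand `‖∇ log (ρ / π)‖²` of the relative Fisher information. -/
def fisherDensity {d : ℕ} (ρ π : State d → ℝ) (x : State d) : ℝ :=
  ‖gradient (fun y => Real.log (ρ y / π y)) x‖ ^ 2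

/-- Relative Fisher information `F(ρ ‖ π) = E_ρ ‖∇ log (ρ / π)‖²`
(used only where the integrand is integrable). -/
def fisherInfo {d : ℕ} (ρ π : State d → ℝ) : ℝ :=
  ∫ x, fisherDensity ρ π x ∂(densityMeasure ρ)

/-- Score matching loss `L(σ, ρ) = E_ρ ‖σ - ∇ log ρ‖²`
(used only where the integrand is integrable). -/
def trueLoss {d : ℕ} (σ : State d → State d) (ρ : State d → ℝ) : ℝ :=
  ∫ x, ‖σ x - score ρ x‖ ^ 2 ∂(densityMeasure ρ)

/-- Training loss `Lⁿ(σ, ρ) = (1/n) ∑ i, ‖σ (x i) - ∇ log ρ (x i)‖²` on the sample `x`. -/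
def empiricalLoss {d n : ℕ} (σ : State d → State d) (ρ : State d → ℝ) (x : Fin n → State d) : ℝ :=
  (n : ℝ)⁻¹ * ∑ i, ‖σ (x i) - score ρ (x i)‖ ^ 2

/-- The partial derivative `∂ s^a (x) / ∂ θ_k` of the `a`-th output of the network. -/
def weightDeriv {d N : ℕ} (s : Weights N → State d → State d) (θ : Weights N) (x : State d)
    (k : Fin N) (a : Fin d) : ℝ :=
  (fderiv ℝ (fun θ' => s θ' x) θ (EuclideanSpace.single k 1)) a

/-- Neural tangent kernel on the sample `x`:
`H^{i,j}_{a,b} = ∑ k, ∂_{θ_k} s^a (x i) * ∂_{θ_k} s^b (x j)`. -/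
def ntk {d n N : ℕ} (s : Weights N → State d → State d) (θ : Weights N) (x : Fin n → State d) :
    Matrix (Fin n × Fin d) (Fin n × Fin d) ℝ :=
  fun p q => ∑ k, weightDeriv s θ (x p.1) k p.2 * weightDeriv s θ (x q.1) k q.2

/-- The symmetric matrix `H` is bounded below by `lam`: `⟨v, H v⟩ ≥ lam * ‖v‖²`. -/
def LowerBounded {ι : Type*} [Fintype ι] (H : Matrix ι ι ℝ) (lam : ℝ) : Prop :=
  ∀ v : ι → ℝ, lam * ∑ p, v p ^ 2 ≤ ∑ p, v p * H.mulVec v p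

/-- Log-Sobolev inequality with constant `α`: `KL(ρ ‖ π) ≤ α * F(ρ ‖ π)` for all
positive `C¹` probability densities `ρ` of finite relative Fisher information. -/
def LogSobolev {d : ℕ} (π : State d → ℝ) (α : ℝ) : Prop :=
  ∀ ρ : State d → ℝ, ContDiff ℝ 1 ρ → (∀ x, 0 < ρ x) → ∫ x, ρ x = 1 →
    Integrable (fisherDensity ρ π) (densityMeasure ρ) →
    relEntropy ρ π ≤ ENNReal.ofReal (α * fisherInfo ρ π)

/-- The coupled particle and weight dynamics on the time interval `[0, T]`:
`X i t` is the `i`-th particle, `Θ t` are the weights, `f t` is the density of the particles and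
`η` is the training rate. The time derivatives are one-sided at `0` and `T`. -/
structure Dynamics {Ω : Type*} [MeasurableSpace Ω] (P : Measure Ω) {d n N : ℕ} (T : ℝ)
    (π : State d → ℝ) (s : Weights N → State d → State d) (η : ℝ → Ω → ℝ)
    (f : ℝ → State d → ℝ) (X : Fin n → ℝ → Ω → State d) (Θ : ℝ → Ω → Weights N) : Prop where
  /-- `X i t ∼ f t`. -/
  law : ∀ i, ∀ t ∈ Icc 0 T, HasLaw (X i t) (densityMeasure (f t)) P
  /-- The initial particles are independent. -/
  indep : iIndepFun (fun i => X i 0) P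
  /-- The weights are random variables. -/
  weights : ∀ t ∈ Icc 0 T, AEMeasurable (Θ t) P
  /-- `dX/dt = ∇ log π (X) - s^Θ (X)` for each particle. -/
  particle_flow : ∀ᵐ ω ∂P, ∀ t ∈ Icc 0 T, ∀ i,
    HasDerivWithinAt (fun τ => X i τ ω) (score π (X i t ω) - s (Θ t ω) (X i t ω)) (Icc 0 T) t
  /-- `dΘ/dt = - η ∇_Θ Lⁿ(s^Θ, f)`. -/
  weight_flow : ∀ᵐ ω ∂P, ∀ t ∈ Icc 0 T,
    HasDerivWithinAt (fun τ => Θ τ ω)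
      (-(η t ω) • gradient
        (fun θ => empiricalLoss (s θ) (f t) (fun i => X i t ω)) (Θ t ω)) (Icc 0 T) t

/-- The condition of sufficient training. At each time of `[0, T]` the neural tangent kernel on the
particles is bounded below by some `lam > 0`, and the training rate satisfies `η ≥ 0` and
`η ≥ (n / lam) * d/dτ log Lⁿ(s_t, f_τ)` at `τ = t`. In this derivative the weights are frozen at
time `t`, while the density and the particles move. The logarithmic derivative is meaningful, and
the second inequality required, only where `Lⁿ(s_t, f_t) > 0`. -/
def SufficientTraining {Ω : Type*} [MeasurableSpace Ω] (P : Measure Ω) {d n N : ℕ} (T : ℝ)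
    (s : Weights N → State d → State d) (η lam : ℝ → Ω → ℝ)
    (f : ℝ → State d → ℝ) (X : Fin n → ℝ → Ω → State d) (Θ : ℝ → Ω → Weights N) : Prop :=
  ∀ᵐ ω ∂P, ∀ t ∈ Icc 0 T,
    0 < lam t ω ∧
    LowerBounded (ntk s (Θ t ω) (fun i => X i t ω)) (lam t ω) ∧
    0 ≤ η t ω ∧
    (0 < empiricalLoss (s (Θ t ω)) (f t) (fun i => X i t ω) →
      n / lam t ω * derivWithin
        (fun τ => Real.log (empiricalLoss (s (Θ t ω)) (f τ) (fun i => X i τ ω))) (Icc 0 T) t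
      ≤ η t ω)

/-- Standing regularity of the particle density on `[0, T]` relative to the target `π`. -/
structure RegularDensity {d : ℕ} (T : ℝ) (π : State d → ℝ) (f : ℝ → State d → ℝ) : Prop where
  pos : ∀ t ∈ Icc 0 T, ∀ x, 0 < f t x
  /-- `f` is `C²` jointly in time and space. -/
  contDiff : ContDiffOn ℝ 2 (fun p : ℝ × State d => f p.1 p.2) (Icc 0 T ×ˢ univ)
  /-- The initial relative entropy is finite. -/
  entropy_ne_top : relEntropy (f 0) π ≠ ⊤
  /-- The relative Fisher information is finite. -/
  fisher : ∀ t ∈ Icc 0 T, Integrable (fisherDensity (f t) π) (densityMeasure (f t))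
  /-- `(1 + |log (f / π)|) ∂f/∂t` is dominated by an integrable function uniformly in time. -/
  dominated : ∃ g : State d → ℝ, Integrable g ∧ ∀ t ∈ Icc 0 T, ∀ x,
    |derivWithin (fun τ => f τ x) (Icc 0 T) t| * (1 + |Real.log (f t x / π x)|) ≤ g x

end SBTM

end

open SBTM

/-!
The lower bound on the neural tangent kernel is a Polyak–Łojasiewicz inequality for the training
loss. Gradient descent at the prescribed rate therefore beats the drift of the loss with frozen
weights, and along almost every path the training loss never exceeds its initial value.

Every particle has law `f t`, so by exchanging sum and expectation some particle has expected
squared score error at most this value. Its flow gives a weak transport equation for `f t`, which is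
extended from test functions to `log (f t / π)` by truncation in space and in value. The outcome is
`-d/dt KL = F + E⟪∇ log (f / π), s - ∇ log f⟫ ≥ F / 2 - E‖s - ∇ log f‖² / 2`,
and the decay of `KL` under a log-Sobolev inequality is Grönwall's inequality.
-/

namespace SBTM

open Filter Topology

section Calculus

variable {α E : Type*} [MeasurableSpace α] {μ : Measure α} [NormedAddCommGroup E] [NormedSpace ℝ E]
  {I : Set ℝ} {F F' : ℝ → α → E} {bound : α → ℝ} {t t₀ : ℝ}

lemma ae_norm_sub_le_of_hasDerivWithinAt (hI : Convex ℝ I)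
    (hderiv : ∀ᵐ a ∂μ, ∀ τ ∈ I, HasDerivWithinAt (fun τ => F τ a) (F' τ a) I τ)
    (hbound : ∀ᵐ a ∂μ, ∀ τ ∈ I, ‖F' τ a‖ ≤ bound a) :
    ∀ᵐ a ∂μ, ∀ t ∈ I, ∀ τ ∈ I, ‖F τ a - F t a‖ ≤ bound a * ‖τ - t‖ := by
  filter_upwards [hderiv, hbound] with a hda hba t ht τ hτ
  exact hI.norm_image_sub_le_of_norm_hasDerivWithin_le hda hba ht hτ

lemma integrable_of_hasDerivWithinAt_of_dominated (hI : Convex ℝ I)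
    (hmeas : ∀ τ ∈ I, AEStronglyMeasurable (F τ) μ) (hb : Integrable bound μ)
    (hderiv : ∀ᵐ a ∂μ, ∀ τ ∈ I, HasDerivWithinAt (fun τ => F τ a) (F' τ a) I τ)
    (hbound : ∀ᵐ a ∂μ, ∀ τ ∈ I, ‖F' τ a‖ ≤ bound a)
    (ht₀ : t₀ ∈ I) (hint : Integrable (F t₀) μ) (ht : t ∈ I) : Integrable (F t) μ := by
  have hsub : Integrable (fun a => F t a - F t₀ a) μ := by
    refine (hb.mul_const ‖t - t₀‖).mono' ((hmeas t ht).sub (hmeas t₀ ht₀)) ?_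
    filter_upwards [ae_norm_sub_le_of_hasDerivWithinAt hI hderiv hbound] with a ha
    exact ha t₀ ht₀ t ht
  exact (hsub.add hint).congr (ae_of_all _ fun a => sub_add_cancel _ _)

lemma hasDerivWithinAt_integral_of_dominated (hI : Convex ℝ I)
    (hmeas : ∀ τ ∈ I, AEStronglyMeasurable (F τ) μ) (hb : Integrable bound μ)
    (hderiv : ∀ᵐ a ∂μ, ∀ τ ∈ I, HasDerivWithinAt (fun τ => F τ a) (F' τ a) I τ)
    (hbound : ∀ᵐ a ∂μ, ∀ τ ∈ I, ‖F' τ a‖ ≤ bound a)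
    (ht : t ∈ I) (hint : Integrable (F t) μ) :
    HasDerivWithinAt (fun τ => ∫ a, F τ a ∂μ) (∫ a, F' t a ∂μ) I t := by
  have hslope : Tendsto (fun τ => ∫ a, slope (fun τ => F τ a) t τ ∂μ) (𝓝[I \ {t}] t)
      (𝓝 (∫ a, F' t a ∂μ)) := by
    refine tendsto_integral_filter_of_dominated_convergence bound ?_ ?_ hb ?_
    · filter_upwards [self_mem_nhdsWithin] with τ hτ
      exact ((hmeas τ hτ.1).sub (hmeas t ht)).const_smul _
    · filter_upwards [self_mem_nhdsWithin] with τ hτ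
      filter_upwards [ae_norm_sub_le_of_hasDerivWithinAt hI hderiv hbound] with a ha
      have hne : 0 < ‖τ - t‖ := norm_pos_iff.2 (sub_ne_zero.2 hτ.2)
      rw [slope_def_module, norm_smul, norm_inv, inv_mul_le_iff₀ hne, mul_comm]
      exact ha t ht τ hτ.1
    · filter_upwards [hderiv] with a ha
      exact hasDerivWithinAt_iff_tendsto_slope.1 (ha t ht)
  refine hasDerivWithinAt_iff_tendsto_slope.2 (hslope.congr' ?_)
  filter_upwards [self_mem_nhdsWithin] with τ hτ
  have hintτ := integrable_of_hasDerivWithinAt_of_dominated hI hmeas hb hderiv hbound ht hint hτ.1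
  simp only [slope_def_module]
  rw [integral_smul, integral_sub hintτ hint]

lemma le_mul_exp_of_hasDerivWithinAt_le {a b c : ℝ} {u u' : ℝ → ℝ}
    (hu : ∀ t ∈ Icc a b, HasDerivWithinAt u (u' t) (Icc a b) t)
    (hle : ∀ t ∈ Icc a b, u' t ≤ c * u t) (ht : t ∈ Icc a b) :
    u t ≤ u a * Real.exp (c * (t - a)) := by
  rw [← gronwallBound_ε0]
  refine le_gronwallBound_of_liminf_deriv_right_le
    (fun τ hτ => (hu τ hτ).continuousWithinAt) (fun τ hτ r hr => ?_) le_rfl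
    (fun τ hτ => (hle τ (Ico_subset_Icc_self hτ)).trans_eq (add_zero _).symm) t ht
  exact ((hu τ (Ico_subset_Icc_self hτ)).mono_of_mem_nhdsWithin
    (Icc_mem_nhdsGE_of_mem hτ)).liminf_right_slope_le hr

end Calculus

section Density

variable {d : ℕ} {ρ π : State d → ℝ}

lemma integral_densityMeasure (hρ : Measurable ρ) (hρ₀ : ∀ x, 0 ≤ ρ x) (φ : State d → ℝ) :
    ∫ x, φ x ∂(densityMeasure ρ) = ∫ x, ρ x * φ x := by
  rw [densityMeasure, integral_withDensity_eq_integral_toReal_smul hρ.ennreal_ofReal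
    (ae_of_all _ fun x => ENNReal.ofReal_lt_top)]
  simp only [ENNReal.toReal_ofReal (hρ₀ _), smul_eq_mul]

lemma integrable_densityMeasure_iff (hρ : Measurable ρ) (hρ₀ : ∀ x, 0 ≤ ρ x)
    {φ : State d → ℝ} :
    Integrable φ (densityMeasure ρ) ↔ Integrable (fun x => ρ x * φ x) := by
  rw [densityMeasure, integrable_withDensity_iff_integrable_smul' hρ.ennreal_ofReal
    (ae_of_all _ fun x => ENNReal.ofReal_lt_top)]
  simp only [ENNReal.toReal_ofReal (hρ₀ _), smul_eq_mul]

lemma isProbabilityMeasure_densityMeasure_iff (hρ : Measurable ρ) (hρ₀ : ∀ x, 0 ≤ ρ x) :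
    IsProbabilityMeasure (densityMeasure ρ) ↔ ∫ x, ρ x = 1 := by
  rw [isProbabilityMeasure_iff, densityMeasure, withDensity_apply _ MeasurableSet.univ,
    Measure.restrict_univ, integral_eq_lintegral_of_nonneg_ae (ae_of_all _ hρ₀)
      hρ.aestronglyMeasurable, ENNReal.toReal_eq_one_iff]

lemma densityMeasure_eq_withDensity_div (hρ : Measurable ρ) (hπ : Measurable π)
    (hπ_pos : ∀ x, 0 < π x) :
    densityMeasure ρ = (densityMeasure π).withDensity (fun x => ENNReal.ofReal (ρ x / π x)) := by
  have hdiv : Measurable fun x => ENNReal.ofReal (ρ x / π x) := (hρ.div hπ).ennreal_ofReal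
  rw [densityMeasure, densityMeasure, ← withDensity_mul _ hπ.ennreal_ofReal hdiv]
  congr 1 with x
  rw [Pi.mul_apply, ← ENNReal.ofReal_mul (hπ_pos x).le, mul_div_cancel₀ _ (hπ_pos x).ne']

lemma densityMeasure_absolutelyContinuous (hρ : Measurable ρ) (hπ : Measurable π)
    (hπ_pos : ∀ x, 0 < π x) : densityMeasure ρ ≪ densityMeasure π := by
  rw [densityMeasure_eq_withDensity_div hρ hπ hπ_pos]
  exact withDensity_absolutelyContinuous _ _

lemma llr_densityMeasure (hρ : Measurable ρ) (hπ : Measurable π) (hρ₀ : ∀ x, 0 ≤ ρ x)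
    (hπ_pos : ∀ x, 0 < π x) :
    llr (densityMeasure ρ) (densityMeasure π)
      =ᵐ[densityMeasure ρ] fun x => Real.log (ρ x / π x) := by
  have : SigmaFinite (densityMeasure π) := SigmaFinite.withDensity_ofReal _
  have hdiv : Measurable fun x => ENNReal.ofReal (ρ x / π x) := (hρ.div hπ).ennreal_ofReal
  have hrn := Measure.rnDeriv_withDensity (densityMeasure π) hdiv
  rw [← densityMeasure_eq_withDensity_div hρ hπ hπ_pos] at hrn
  filter_upwards [(densityMeasure_absolutelyContinuous hρ hπ hπ_pos).ae_le hrn] with x hx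
  rw [llr, hx, ENNReal.toReal_ofReal (div_nonneg (hρ₀ x) (hπ_pos x).le)]

lemma relEntropy_ne_top_iff (hρ : Measurable ρ) (hπ : Measurable π) (hρ₀ : ∀ x, 0 ≤ ρ x)
    (hπ_pos : ∀ x, 0 < π x) :
    relEntropy ρ π ≠ ⊤ ↔ Integrable (fun x => ρ x * Real.log (ρ x / π x)) := by
  rw [relEntropy, InformationTheory.klDiv_ne_top_iff,
    and_iff_right (densityMeasure_absolutelyContinuous hρ hπ hπ_pos),
    integrable_congr (llr_densityMeasure hρ hπ hρ₀ hπ_pos), integrable_densityMeasure_iff hρ hρ₀]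

lemma toReal_relEntropy (hρ : Measurable ρ) (hπ : Measurable π) (hρ₀ : ∀ x, 0 ≤ ρ x)
    (hπ_pos : ∀ x, 0 < π x) (hρ_one : ∫ x, ρ x = 1) (hπ_one : ∫ x, π x = 1) :
    (relEntropy ρ π).toReal = ∫ x, ρ x * Real.log (ρ x / π x) := by
  have := (isProbabilityMeasure_densityMeasure_iff hρ hρ₀).2 hρ_one
  have := (isProbabilityMeasure_densityMeasure_iff hπ fun x => (hπ_pos x).le).2 hπ_one
  rw [relEntropy, InformationTheory.toReal_klDiv_of_measure_eq
      (densityMeasure_absolutelyContinuous hρ hπ hπ_pos) (by simp only [measure_univ]),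
    integral_congr_ae (llr_densityMeasure hρ hπ hρ₀ hπ_pos), integral_densityMeasure hρ hρ₀]

lemma fisherInfo_nonneg (ρ π : State d → ℝ) : 0 ≤ fisherInfo ρ π :=
  integral_nonneg fun _ => sq_nonneg _

end Density

section Slices

variable {E : Type*} [NormedAddCommGroup E] [NormedSpace ℝ E] {I : Set ℝ} {f : ℝ → E → ℝ} {t : ℝ}

/-- The time derivative `∂ₜ f` of a curve of functions, taken within the time set `I` and hence
one-sided at the endpoints of an interval. -/
noncomputable def timeDeriv (I : Set ℝ) (f : ℝ → E → ℝ) (t : ℝ) (x : E) : ℝ :=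
  derivWithin (fun τ => f τ x) I t

lemma contDiff_slice {m : WithTop ℕ∞}
    (hf : ContDiffOn ℝ m (fun p : ℝ × E => f p.1 p.2) (I ×ˢ univ)) (ht : t ∈ I) :
    ContDiff ℝ m (f t) :=
  hf.comp_contDiff (f := fun x : E => (t, x)) (by fun_prop) fun x => ⟨ht, mem_univ x⟩

lemma hasDerivWithinAt_timeSlice {x : E}
    (hf : DifferentiableWithinAt ℝ (fun p : ℝ × E => f p.1 p.2) (I ×ˢ univ) (t, x)) :
    HasDerivWithinAt (fun τ => f τ x)
      (fderivWithin ℝ (fun p : ℝ × E => f p.1 p.2) (I ×ˢ univ) (t, x) (1, 0)) I t :=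
  hf.hasFDerivWithinAt.comp_hasDerivWithinAt (f := fun τ => (τ, x)) t
    ((hasDerivWithinAt_id t I).prodMk (hasDerivWithinAt_const t I x))
    fun _ hτ => ⟨hτ, mem_univ x⟩

lemma hasFDerivAt_slice {x : E} (ht : t ∈ I)
    (hf : DifferentiableWithinAt ℝ (fun p : ℝ × E => f p.1 p.2) (I ×ˢ univ) (t, x)) :
    HasFDerivAt (f t)
      ((fderivWithin ℝ (fun p : ℝ × E => f p.1 p.2) (I ×ˢ univ) (t, x)).comp
        (ContinuousLinearMap.inr ℝ ℝ E)) x :=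
  hasFDerivWithinAt_univ.1 <| hf.hasFDerivWithinAt.comp (f := fun y : E => (t, y)) x
    (hasFDerivAt_prodMk_right t x).hasFDerivWithinAt fun y _ => ⟨ht, mem_univ y⟩

lemma continuous_timeDeriv (hI : UniqueDiffOn ℝ I)
    (hf : ContDiffOn ℝ 1 (fun p : ℝ × E => f p.1 p.2) (I ×ˢ univ)) (ht : t ∈ I) :
    Continuous (timeDeriv I f t) := by
  have hcont : Continuous fun x =>
      fderivWithin ℝ (fun p : ℝ × E => f p.1 p.2) (I ×ˢ univ) (t, x) (1, 0) :=
    ((hf.continuousOn_fderivWithin (hI.prod uniqueDiffOn_univ) le_rfl).comp_continuous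
      (by fun_prop) fun x => ⟨ht, mem_univ x⟩).clm_apply continuous_const
  refine hcont.congr fun x => ?_
  exact ((hasDerivWithinAt_timeSlice (hf.differentiableOn one_ne_zero (t, x)
    ⟨ht, mem_univ x⟩)).derivWithin (hI t ht)).symm

end Slices

section Score

variable {d : ℕ} {ρ π : State d → ℝ}

lemma continuous_score (hρ : ContDiff ℝ 1 ρ) (hρ₀ : ∀ x, ρ x ≠ 0) : Continuous (score ρ) :=
  (InnerProductSpace.toDual ℝ (State d)).symm.continuous.comp
    ((hρ.log hρ₀).continuous_fderiv one_ne_zero)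

lemma gradient_log_div {x : State d} (hρ : DifferentiableAt ℝ ρ x) (hπ : DifferentiableAt ℝ π x)
    (hρ₀ : ρ x ≠ 0) (hπ₀ : π x ≠ 0) :
    gradient (fun y => Real.log (ρ y / π y)) x = score ρ x - score π x := by
  have hlog : (fun y => Real.log (ρ y / π y))
      =ᶠ[𝓝 x] fun y => Real.log (ρ y) - Real.log (π y) := by
    filter_upwards [hρ.continuousAt.eventually_ne hρ₀, hπ.continuousAt.eventually_ne hπ₀]
      with y hρy hπy using Real.log_div hρy hπy
  rw [hlog.gradient_eq, score, score, gradient, gradient, gradient,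
    fderiv_fun_sub (hρ.log hρ₀) (hπ.log hπ₀), map_sub]

lemma differentiableOn_score {I : Set ℝ} (hI : UniqueDiffOn ℝ I) {f : ℝ → State d → ℝ}
    (hf : ContDiffOn ℝ 2 (fun p : ℝ × State d => f p.1 p.2) (I ×ˢ univ))
    (hf₀ : ∀ t ∈ I, ∀ x, f t x ≠ 0) :
    DifferentiableOn ℝ (fun p : ℝ × State d => score (f p.1) p.2) (I ×ˢ univ) := by
  have hlog : ContDiffOn ℝ 2 (fun p : ℝ × State d => Real.log (f p.1 p.2)) (I ×ˢ univ) :=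
    hf.log fun p hp => hf₀ p.1 hp.1 p.2
  have hfderiv := (hlog.fderivWithin (hI.prod uniqueDiffOn_univ) (m := 1)
    (by norm_num)).differentiableOn one_ne_zero
  refine ((InnerProductSpace.toDual ℝ (State d)).symm.toContinuousLinearEquiv.differentiable
    |>.comp_differentiableOn (hfderiv.clm_comp
      (differentiableOn_const (ContinuousLinearMap.inr ℝ ℝ (State d))))).congr fun p hp => ?_
  exact congrArg (InnerProductSpace.toDual ℝ (State d)).symm
    (hasFDerivAt_slice (f := fun t x => Real.log (f t x)) hp.1
      (hlog.differentiableOn two_ne_zero p hp)).fderiv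

end Score

section GradientFlow

variable {E : Type*} [NormedAddCommGroup E] [InnerProductSpace ℝ E] [CompleteSpace E] {I : Set ℝ}
  {Φ : ℝ → E → ℝ} {θ : ℝ → E} {t : ℝ}

lemma hasDerivWithinAt_along_curve {θ' : E}
    (hΦ : DifferentiableWithinAt ℝ (fun p : ℝ × E => Φ p.1 p.2) (I ×ˢ univ) (t, θ t))
    (hθ : HasDerivWithinAt θ θ' I t) (ht : t ∈ I) (hI : UniqueDiffWithinAt ℝ I t) :
    HasDerivWithinAt (fun τ => Φ τ (θ τ))
      (timeDeriv I Φ t (θ t) + inner ℝ (gradient (Φ t) (θ t)) θ') I t := by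
  have hcomp := hΦ.hasFDerivWithinAt.comp_hasDerivWithinAt (f := fun τ => (τ, θ τ)) t
    ((hasDerivWithinAt_id t I).prodMk hθ) fun τ hτ => ⟨hτ, mem_univ (θ τ)⟩
  refine hcomp.congr_deriv ?_
  rw [timeDeriv, (hasDerivWithinAt_timeSlice hΦ).derivWithin hI, inner_gradient_left,
    (hasFDerivAt_slice ht hΦ).fderiv, ContinuousLinearMap.comp_apply,
    ContinuousLinearMap.inr_apply, ← map_add, Prod.mk_add_mk, add_zero, zero_add]

lemma antitoneOn_of_gradientFlow {η m : ℝ → ℝ} (hI : Convex ℝ I)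
    (hΦ : ∀ t ∈ I, DifferentiableWithinAt ℝ (fun p : ℝ × E => Φ p.1 p.2) (I ×ˢ univ) (t, θ t))
    (hΦ₀ : ∀ t ∈ I, 0 ≤ Φ t (θ t))
    (hθ : ∀ t ∈ I, HasDerivWithinAt θ (-(η t) • gradient (Φ t) (θ t)) I t)
    (hη : ∀ t ∈ I, 0 ≤ η t)
    (hPL : ∀ t ∈ I, m t * Φ t (θ t) ≤ ‖gradient (Φ t) (θ t)‖ ^ 2)
    (hrate : ∀ t ∈ I, 0 < Φ t (θ t) →
      derivWithin (fun τ => Real.log (Φ τ (θ t))) I t ≤ m t * η t) :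
    AntitoneOn (fun t => Φ t (θ t)) I := by
  have hcont : ContinuousOn (fun t => Φ t (θ t)) I := fun t ht =>
    (hΦ t ht).continuousWithinAt.comp (f := fun τ => (τ, θ τ))
      (continuousWithinAt_id.prodMk (hθ t ht).continuousWithinAt) fun τ hτ => ⟨hτ, mem_univ (θ τ)⟩
  have hderiv : ∀ t ∈ interior I, HasDerivAt (fun t => Φ t (θ t))
      (timeDeriv I Φ t (θ t) - η t * ‖gradient (Φ t) (θ t)‖ ^ 2) t := fun t ht => by
    have hI_nhds := mem_interior_iff_mem_nhds.1 ht
    refine ((hasDerivWithinAt_along_curve (hΦ t (interior_subset ht)) (hθ t (interior_subset ht))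
      (interior_subset ht) (uniqueDiffWithinAt_of_mem_nhds hI_nhds)).hasDerivAt
      hI_nhds).congr_deriv ?_
    rw [real_inner_smul_right, real_inner_self_eq_norm_sq, neg_mul, sub_eq_add_neg]
  refine antitoneOn_of_hasDerivWithinAt_nonpos hI hcont
    (fun t ht => (hderiv t ht).hasDerivWithinAt) fun t ht => ?_
  have htI := interior_subset ht
  have hI_nhds := mem_interior_iff_mem_nhds.1 ht
  rcases (hΦ₀ t htI).eq_or_lt' with hzero | hpos
  · have hmin : IsLocalMin (fun t => Φ t (θ t)) t := by
      filter_upwards [hI_nhds] with τ hτ using hzero.trans_le (hΦ₀ τ hτ)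
    exact (hmin.hasDerivAt_eq_zero (hderiv t ht)).le
  · have hlog : derivWithin (fun τ => Real.log (Φ τ (θ t))) I t
        = timeDeriv I Φ t (θ t) / Φ t (θ t) :=
      ((hasDerivWithinAt_timeSlice (hΦ t htI)).differentiableWithinAt.hasDerivWithinAt.log
        hpos.ne').derivWithin (uniqueDiffWithinAt_of_mem_nhds hI_nhds)
    have hdrift := hrate t htI hpos
    rw [hlog, div_le_iff₀ hpos] at hdrift
    refine sub_nonpos.2 (hdrift.trans ?_)
    calc m t * η t * Φ t (θ t) = η t * (m t * Φ t (θ t)) := by ring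
      _ ≤ η t * ‖gradient (Φ t) (θ t)‖ ^ 2 := mul_le_mul_of_nonneg_left (hPL t htI) (hη t htI)

end GradientFlow

section TrainingLoss

variable {d n N : ℕ}

lemma norm_sq_le_empiricalLoss (σ : State d → State d) (ρ : State d → ℝ) (x : Fin n → State d)
    (i : Fin n) : ‖σ (x i) - score ρ (x i)‖ ^ 2 ≤ n * empiricalLoss σ ρ x := by
  rw [empiricalLoss, mul_inv_cancel_left₀ (Nat.cast_ne_zero.2 i.pos.ne')]
  exact Finset.single_le_sum (f := fun i => ‖σ (x i) - score ρ (x i)‖ ^ 2)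
    (fun j _ => sq_nonneg _) (Finset.mem_univ i)

lemma empiricalLoss_nonneg (σ : State d → State d) (ρ : State d → ℝ) (x : Fin n → State d) :
    0 ≤ empiricalLoss σ ρ x :=
  mul_nonneg (inv_nonneg.2 n.cast_nonneg) (Finset.sum_nonneg fun _ _ => sq_nonneg _)

variable {s : Weights N → State d → State d} {θ : Weights N} {x : Fin n → State d}

lemma hasGradientAt_empiricalLoss (ρ : State d → ℝ)
    (hs : ∀ i, DifferentiableAt ℝ (fun θ' => s θ' (x i)) θ) :
    HasGradientAt (fun θ' => empiricalLoss (s θ') ρ x)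
      ((2 / n : ℝ) • ∑ i, (fderiv ℝ (fun θ' => s θ' (x i)) θ).adjoint
        (s θ (x i) - score ρ (x i))) θ := by
  have hderiv : HasFDerivAt (fun θ' => empiricalLoss (s θ') ρ x) _ θ :=
    (HasFDerivAt.fun_sum fun i _ => ((hs i).hasFDerivAt.sub_const _).norm_sq).const_mul _
  rw [hasGradientAt_iff_hasFDerivAt]
  refine hderiv.congr_fderiv (ContinuousLinearMap.ext fun w => ?_)
  simp only [smul_apply, sum_apply,
    ContinuousLinearMap.comp_apply, innerSL_apply_apply, InnerProductSpace.toDual_apply_apply,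
    real_inner_smul_left, sum_inner, ContinuousLinearMap.adjoint_inner_left, smul_eq_mul,
    nsmul_eq_mul, ← Finset.mul_sum, Nat.cast_ofNat]
  ring

lemma adjoint_fderiv_apply (s : Weights N → State d → State d) (θ : Weights N) (y v : State d)
    (k : Fin N) :
    (fderiv ℝ (fun θ' => s θ' y) θ).adjoint v k = ∑ a, v a * weightDeriv s θ y k a := by
  have hinner := ContinuousLinearMap.adjoint_inner_left (fderiv ℝ (fun θ' => s θ' y) θ)
    (EuclideanSpace.single k (1 : ℝ)) v
  rw [EuclideanSpace.inner_single_right, one_mul, conj_trivial] at hinner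
  rw [hinner, PiLp.inner_apply]
  exact Finset.sum_congr rfl fun a _ => mul_comm _ _

lemma sum_mul_ntk_mulVec (s : Weights N → State d → State d) (θ : Weights N)
    (x v : Fin n → State d) :
    ∑ p : Fin n × Fin d, v p.1 p.2 * (ntk s θ x).mulVec (fun q => v q.1 q.2) p
      = ‖∑ i, (fderiv ℝ (fun θ' => s θ' (x i)) θ).adjoint (v i)‖ ^ 2 := by
  have hcoord : ∀ k, (∑ i, (fderiv ℝ (fun θ' => s θ' (x i)) θ).adjoint (v i)) k
      = ∑ p : Fin n × Fin d, v p.1 p.2 * weightDeriv s θ (x p.1) k p.2 := fun k => by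
    rw [WithLp.ofLp_sum, Finset.sum_apply, Fintype.sum_prod_type]
    exact Finset.sum_congr rfl fun i _ => adjoint_fderiv_apply s θ (x i) (v i) k
  rw [EuclideanSpace.real_norm_sq_eq]
  simp only [hcoord, Matrix.mulVec, dotProduct, ntk, Finset.sum_mul, Finset.mul_sum, sq]
  rw [Finset.sum_comm_cycle]
  refine Finset.sum_congr rfl fun k _ => ?_
  rw [Finset.sum_comm]
  refine Finset.sum_congr rfl fun p _ => Finset.sum_congr rfl fun q _ => ?_
  ring

-- A Polyak–Łojasiewicz inequality.
lemma LowerBounded.mul_empiricalLoss_le_norm_gradient_sq {l : ℝ} (hH : LowerBounded (ntk s θ x) l)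
    (ρ : State d → ℝ) (hs : ∀ i, DifferentiableAt ℝ (fun θ' => s θ' (x i)) θ) :
    4 * l / n * empiricalLoss (s θ) ρ x
      ≤ ‖gradient (fun θ' => empiricalLoss (s θ') ρ x) θ‖ ^ 2 := by
  rw [(hasGradientAt_empiricalLoss ρ hs).gradient, norm_smul, mul_pow, ← sum_mul_ntk_mulVec,
    Real.norm_eq_abs, sq_abs]
  refine Eq.trans_le ?_ (mul_le_mul_of_nonneg_left (hH _) (sq_nonneg _))
  rw [Fintype.sum_prod_type, empiricalLoss]
  simp only [← EuclideanSpace.real_norm_sq_eq]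
  ring

lemma differentiableWithinAt_empiricalLoss {I : Set ℝ} {t : ℝ} {f : ℝ → State d → ℝ}
    {x : Fin n → ℝ → State d} (hs : Differentiable ℝ fun p : Weights N × State d => s p.1 p.2)
    (hf : DifferentiableOn ℝ (fun p : ℝ × State d => score (f p.1) p.2) (I ×ˢ univ))
    (hx : ∀ i, DifferentiableWithinAt ℝ (x i) I t) (ht : t ∈ I) (θ : Weights N) :
    DifferentiableWithinAt ℝ
      (fun p : ℝ × Weights N => empiricalLoss (s p.2) (f p.1) fun i => x i p.1)
      (I ×ˢ univ) (t, θ) := by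
  refine (DifferentiableWithinAt.fun_sum fun i _ => ?_).const_mul _
  have hxi : DifferentiableWithinAt ℝ (fun p : ℝ × Weights N => x i p.1) (I ×ˢ univ) (t, θ) :=
    (hx i).comp (t, θ) differentiableWithinAt_fst fun p hp => hp.1
  have hnetwork : DifferentiableWithinAt ℝ (fun p : ℝ × Weights N => s p.2 (x i p.1))
      (I ×ˢ univ) (t, θ) :=
    (hs (θ, x i t)).comp_differentiableWithinAt (t, θ) (differentiableWithinAt_snd.prodMk hxi)
  have hscore : DifferentiableWithinAt ℝ (fun p : ℝ × Weights N => score (f p.1) (x i p.1))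
      (I ×ˢ univ) (t, θ) :=
    (hf (t, x i t) ⟨ht, mem_univ _⟩).comp (f := fun p : ℝ × Weights N => (p.1, x i p.1)) (t, θ)
      (differentiableWithinAt_fst.prodMk hxi) fun p hp => ⟨hp.1, mem_univ _⟩
  exact (hnetwork.sub hscore).norm_sq ℝ

lemma antitoneOn_empiricalLoss {I : Set ℝ} {f : ℝ → State d → ℝ} {x : Fin n → ℝ → State d}
    {θ : ℝ → Weights N} {η lam : ℝ → ℝ} (hI : Convex ℝ I)
    (hs : Differentiable ℝ fun p : Weights N × State d => s p.1 p.2)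
    (hf : DifferentiableOn ℝ (fun p : ℝ × State d => score (f p.1) p.2) (I ×ˢ univ))
    (hx : ∀ i, DifferentiableOn ℝ (x i) I)
    (hθ : ∀ t ∈ I, HasDerivWithinAt θ
      (-(η t) • gradient (fun θ' => empiricalLoss (s θ') (f t) fun i => x i t) (θ t)) I t)
    (hη : ∀ t ∈ I, 0 ≤ η t)
    (hH : ∀ t ∈ I, LowerBounded (ntk s (θ t) fun i => x i t) (lam t))
    (hrate : ∀ t ∈ I, 0 < empiricalLoss (s (θ t)) (f t) (fun i => x i t) →
      derivWithin (fun τ => Real.log (empiricalLoss (s (θ t)) (f τ) fun i => x i τ)) I t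
        ≤ 4 * lam t / n * η t) :
    AntitoneOn (fun t => empiricalLoss (s (θ t)) (f t) fun i => x i t) I := by
  refine antitoneOn_of_gradientFlow (Φ := fun t θ => empiricalLoss (s θ) (f t) fun i => x i t)
    (m := fun t => 4 * lam t / n) hI
    (fun t ht => differentiableWithinAt_empiricalLoss hs hf (fun i => hx i t ht) ht (θ t))
    (fun t _ => empiricalLoss_nonneg _ _ _) hθ hη (fun t ht => ?_) hrate
  exact (hH t ht).mul_empiricalLoss_le_norm_gradient_sq (f t) fun i =>
    (hs (θ t, x i t)).comp (f := fun θ' : Weights N => (θ', x i t)) (θ t) (by fun_prop)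

end TrainingLoss

section Truncation

variable {E : Type*} [NormedAddCommGroup E] [NormedSpace ℝ E] {h : E → ℝ} {ε : ℝ} {x : E}

lemma one_add_mul_sq_pos (hε : 0 ≤ ε) (y : ℝ) : 0 < 1 + ε * y ^ 2 := by positivity

lemma hasDerivAt_div_one_add_mul_sq (hε : 0 ≤ ε) (y : ℝ) :
    HasDerivAt (fun y => y / (1 + ε * y ^ 2)) ((1 - ε * y ^ 2) / (1 + ε * y ^ 2) ^ 2) y := by
  refine ((hasDerivAt_id y).div (((hasDerivAt_pow 2 y).const_mul ε).const_add 1)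
    (one_add_mul_sq_pos hε y).ne').congr_deriv ?_
  simp only [id_eq, Nat.cast_ofNat, Nat.add_one_sub_one, pow_one]
  ring

section

variable [HasContDiffBump E]

/-- The truncation of a function `h` at scale `1 / ε`, in space by the cutoff `χ` and in value by
the map `y ↦ y / (1 + ε y²)`, which is bounded for `ε > 0` and has slope at most `1`. It
approximates `h` by compactly supported functions as `ε → 0`. -/
noncomputable def truncation (χ : ContDiffBump (0 : E)) (ε : ℝ) (h : E → ℝ) (x : E) : ℝ :=
  χ (ε • x) * (h x / (1 + ε * h x ^ 2))

variable (χ : ContDiffBump (0 : E))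

lemma contDiff_truncation (hε : 0 ≤ ε) (hh : ContDiff ℝ 1 h) : ContDiff ℝ 1 (truncation χ ε h) :=
  (χ.contDiff.comp (contDiff_const_smul ε)).mul
    (hh.div (contDiff_const.add (contDiff_const.mul (hh.pow 2)))
      fun x => (one_add_mul_sq_pos hε (h x)).ne')

lemma abs_truncation_le (hε : 0 ≤ ε) (h : E → ℝ) (x : E) : |truncation χ ε h x| ≤ |h x| := by
  have hden : 1 ≤ 1 + ε * h x ^ 2 := le_add_of_nonneg_right (by positivity)
  rw [truncation, abs_mul, abs_of_nonneg χ.nonneg, abs_div, abs_of_pos (one_pos.trans_le hden)]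
  exact (mul_le_of_le_one_left (by positivity) χ.le_one).trans (div_le_self (abs_nonneg _) hden)

lemma hasFDerivAt_truncation (hε : 0 ≤ ε) (hh : DifferentiableAt ℝ h x) :
    HasFDerivAt (truncation χ ε h)
      ((χ (ε • x) * ((1 - ε * h x ^ 2) / (1 + ε * h x ^ 2) ^ 2)) • fderiv ℝ h x
        + (h x / (1 + ε * h x ^ 2) * ε) • fderiv ℝ χ (ε • x)) x := by
  have hcutoff : HasFDerivAt (fun x => χ (ε • x)) (ε • fderiv ℝ χ (ε • x)) x := by
    rw [← fderiv_comp_smul]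
    exact ((χ.contDiff.comp (contDiff_const_smul ε)).differentiable one_ne_zero x).hasFDerivAt
  refine (hcutoff.mul ((hasDerivAt_div_one_add_mul_sq hε (h x)).comp_hasFDerivAt x
    hh.hasFDerivAt)).congr_fderiv ?_
  simp only [smul_smul, Function.comp_apply]

lemma tendsto_truncation (h : E → ℝ) (x : E) :
    Tendsto (fun ε => truncation χ ε h x) (𝓝 0) (𝓝 (h x)) := by
  have hcont : ContinuousAt (fun ε : ℝ => χ (ε • x) * (h x / (1 + ε * h x ^ 2))) 0 := by
    refine (χ.continuous.comp (continuous_id.smul continuous_const)).continuousAt.mul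
      (ContinuousAt.div (by fun_prop) (by fun_prop) (one_add_mul_sq_pos le_rfl _).ne')
  have hχ : χ 0 = 1 := χ.eventuallyEq_one.eq_of_nhds
  simpa only [ContinuousAt, truncation, zero_smul, hχ, zero_mul, add_zero, div_one, one_mul]
    using hcont

lemma tendsto_fderiv_truncation (hh : DifferentiableAt ℝ h x) :
    Tendsto (fun ε => fderiv ℝ (truncation χ ε h) x) (𝓝[≥] 0) (𝓝 (fderiv ℝ h x)) := by
  have hden : (1 : ℝ) + 0 * h x ^ 2 ≠ 0 := (one_add_mul_sq_pos le_rfl _).ne'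
  have hscale : Continuous fun ε : ℝ => ε • x := continuous_id.smul continuous_const
  have hdχ : Continuous (fderiv ℝ χ) := χ.contDiff.continuous_fderiv (n := 1) one_ne_zero
  have hslope : ContinuousAt (fun ε : ℝ => (1 - ε * h x ^ 2) / (1 + ε * h x ^ 2) ^ 2) 0 :=
    ContinuousAt.div (by fun_prop) (by fun_prop) (pow_ne_zero 2 hden)
  have hvalue : ContinuousAt (fun ε : ℝ => h x / (1 + ε * h x ^ 2)) 0 :=
    ContinuousAt.div (by fun_prop) (by fun_prop) hden
  have hcont : ContinuousAt (fun ε : ℝ =>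
      (χ (ε • x) * ((1 - ε * h x ^ 2) / (1 + ε * h x ^ 2) ^ 2)) • fderiv ℝ h x
        + (h x / (1 + ε * h x ^ 2) * ε) • fderiv ℝ χ (ε • x)) 0 :=
    (((χ.continuous.comp hscale).continuousAt.mul hslope).smul continuousAt_const).add
      ((hvalue.mul continuousAt_id).smul (hdχ.comp hscale).continuousAt)
  have hχ : χ 0 = 1 := χ.eventuallyEq_one.eq_of_nhds
  have hlim := hcont.tendsto.mono_left (nhdsWithin_le_nhds (s := Ici 0))
  simp only [zero_smul, hχ, zero_mul, sub_zero, add_zero, one_pow, div_one, mul_one, one_smul,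
    mul_zero] at hlim
  refine hlim.congr' ?_
  filter_upwards [self_mem_nhdsWithin] with ε hε using (hasFDerivAt_truncation χ hε hh).fderiv.symm

end

variable [FiniteDimensional ℝ E] (χ : ContDiffBump (0 : E))

lemma hasCompactSupport_truncation (hε : ε ≠ 0) (h : E → ℝ) :
    HasCompactSupport (truncation χ ε h) :=
  (χ.hasCompactSupport.comp_homeomorph (Homeomorph.smulOfNeZero ε hε)).mul_right

lemma exists_norm_fderiv_truncation_le :
    ∃ C, ∀ (h : E → ℝ) (ε : ℝ) (x : E), ε ∈ Icc 0 1 → DifferentiableAt ℝ h x →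
      ‖fderiv ℝ (truncation χ ε h) x‖ ≤ ‖fderiv ℝ h x‖ + C := by
  obtain ⟨C, hC⟩ := (χ.hasCompactSupport.fderiv (𝕜 := ℝ)).exists_bound_of_continuous
    (χ.contDiff.continuous_fderiv (n := 1) one_ne_zero)
  refine ⟨C, fun h ε x hε hh => ?_⟩
  have hden := one_add_mul_sq_pos hε.1 (h x)
  have hslope : |(1 - ε * h x ^ 2) / (1 + ε * h x ^ 2) ^ 2| ≤ 1 := by
    rw [abs_div, abs_of_pos (pow_pos hden 2), div_le_one (pow_pos hden 2), abs_le]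
    have := mul_nonneg hε.1 (sq_nonneg (h x))
    constructor <;> nlinarith
  have hvalue : |h x / (1 + ε * h x ^ 2) * ε| ≤ 1 := by
    rw [abs_mul, abs_div, abs_of_pos hden, abs_of_nonneg hε.1, div_mul_eq_mul_div,
      div_le_one hden, ← sq_abs]
    nlinarith [hε.1, hε.2, mul_nonneg hε.1 (sq_nonneg (|h x| - 1)), abs_nonneg (h x)]
  rw [(hasFDerivAt_truncation χ hε.1 hh).fderiv]
  refine (norm_add_le _ _).trans (add_le_add ?_ ?_)
  · rw [norm_smul, Real.norm_eq_abs, abs_mul, abs_of_nonneg χ.nonneg]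
    exact mul_le_of_le_one_left (norm_nonneg _) (mul_le_one₀ χ.le_one (abs_nonneg _) hslope)
  · rw [norm_smul]
    exact (mul_le_of_le_one_left (norm_nonneg _) hvalue).trans (hC _)

end Truncation

section WeakContinuityEquation

variable {Ω E : Type*} [MeasurableSpace Ω] [NormedAddCommGroup E] [NormedSpace ℝ E]
  [MeasurableSpace E] {P : Measure Ω}

/-- The weak continuity equation: the mass of density `m` with respect to `ν` gained per unit of
time is transported by particles which sit at `Y` and move with velocity `W`. No conditional
expectation of `W` given `Y` is taken, so that `W` need not be a function of the position. -/
def WeakContinuityEq (ν : Measure E) (m : E → ℝ) (P : Measure Ω) (Y W : Ω → E) : Prop :=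
  ∀ φ : E → ℝ, ContDiff ℝ 1 φ → HasCompactSupport φ →
    ∫ x, m x * φ x ∂ν = ∫ ω, fderiv ℝ φ (Y ω) (W ω) ∂P

variable [FiniteDimensional ℝ E] [BorelSpace E]

lemma aestronglyMeasurable_fderiv_apply {φ : E → ℝ} (hφ : ContDiff ℝ 1 φ) {Y W : Ω → E}
    (hY : AEMeasurable Y P) (hW : AEStronglyMeasurable W P) :
    AEStronglyMeasurable (fun ω => fderiv ℝ φ (Y ω) (W ω)) P := by
  have : ProperSpace E := FiniteDimensional.proper ℝ E
  have hdφ := (hφ.continuous_fderiv one_ne_zero).comp_aestronglyMeasurable hY.aestronglyMeasurable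
  exact isBoundedBilinearMap_apply.continuous.comp_aestronglyMeasurable (hdφ.prodMk hW)

theorem WeakContinuityEq.integral_mul_eq {ν : Measure E} {m φ : E → ℝ} {Y W : Ω → E}
    (h : WeakContinuityEq ν m P Y W) (hφ : ContDiff ℝ 1 φ) (hm : AEStronglyMeasurable m ν)
    (hmφ : Integrable (fun x => m x * φ x) ν) (hY : AEMeasurable Y P) (hW : Integrable W P)
    (hφW : Integrable (fun ω => ‖fderiv ℝ φ (Y ω)‖ * ‖W ω‖) P) :
    ∫ x, m x * φ x ∂ν = ∫ ω, fderiv ℝ φ (Y ω) (W ω) ∂P := by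
  have hdiff : Differentiable ℝ φ := hφ.differentiable one_ne_zero
  let χ : ContDiffBump (0 : E) := default
  obtain ⟨C, hC⟩ := exists_norm_fderiv_truncation_le χ
  have hpos (k : ℕ) : (0 : ℝ) < 1 / (k + 1) := Nat.one_div_pos_of_nat
  have hscale := tendsto_one_div_add_atTop_nhds_zero_nat (𝕜 := ℝ)
  have hscale' : Tendsto (fun k : ℕ => 1 / ((k : ℝ) + 1)) atTop (𝓝[≥] 0) :=
    tendsto_nhdsWithin_iff.2 ⟨hscale, Eventually.of_forall fun k => (hpos k).le⟩
  let ψ (k : ℕ) : E → ℝ := truncation χ (1 / (k + 1)) φ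
  have hψ (k : ℕ) : ContDiff ℝ 1 (ψ k) := contDiff_truncation χ (hpos k).le hφ
  have hmass : Tendsto (fun k => ∫ x, m x * ψ k x ∂ν) atTop (𝓝 (∫ x, m x * φ x ∂ν)) := by
    refine tendsto_integral_of_dominated_convergence (fun x => ‖m x * φ x‖)
      (fun k => hm.mul (hψ k).continuous.aestronglyMeasurable) hmφ.norm (fun k => ?_)
      (ae_of_all _ fun x => ((tendsto_truncation χ φ x).comp hscale).const_mul _)
    refine ae_of_all _ fun x => ?_
    rw [norm_mul, norm_mul]
    exact mul_le_mul_of_nonneg_left (abs_truncation_le χ (hpos k).le φ x) (norm_nonneg _)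
  have hflux : Tendsto (fun k => ∫ ω, fderiv ℝ (ψ k) (Y ω) (W ω) ∂P) atTop
      (𝓝 (∫ ω, fderiv ℝ φ (Y ω) (W ω) ∂P)) := by
    refine tendsto_integral_of_dominated_convergence
      (fun ω => ‖fderiv ℝ φ (Y ω)‖ * ‖W ω‖ + C * ‖W ω‖)
      (fun k => aestronglyMeasurable_fderiv_apply (hψ k) hY hW.1)
      (hφW.add (hW.norm.const_mul C)) (fun k => ae_of_all _ fun ω => ?_)
      (ae_of_all _ fun ω => ?_)
    · rw [← add_mul]
      exact (fderiv ℝ (ψ k) (Y ω)).le_of_opNorm_le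
        (hC φ _ _ ⟨(hpos k).le, (div_le_one₀ (by positivity)).2
          (le_add_of_nonneg_left k.cast_nonneg)⟩ (hdiff _)) _
    · exact ((ContinuousLinearMap.apply ℝ ℝ (W ω)).continuous.tendsto _).comp
        ((tendsto_fderiv_truncation χ (hdiff (Y ω))).comp hscale')
  refine tendsto_nhds_unique hmass (hflux.congr fun k => ?_)
  exact (h (ψ k) (hψ k) (hasCompactSupport_truncation χ (hpos k).ne' φ)).symm

lemma hasDerivWithinAt_integral_testFunction [IsFiniteMeasure P] {I : Set ℝ} (hI : Convex ℝ I)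
    {Y W : ℝ → Ω → E} {t : ℝ} (hY : ∀ τ ∈ I, AEMeasurable (Y τ) P)
    (hflow : ∀ᵐ ω ∂P, ∀ τ ∈ I, HasDerivWithinAt (fun τ => Y τ ω) (W τ ω) I τ)
    (hbound : ∀ K, IsCompact K → ∃ M, ∀ᵐ ω ∂P, ∀ τ ∈ I, Y τ ω ∈ K → ‖W τ ω‖ ≤ M)
    {φ : E → ℝ} (hφ : ContDiff ℝ 1 φ) (hφc : HasCompactSupport φ) (ht : t ∈ I) :
    HasDerivWithinAt (fun τ => ∫ ω, φ (Y τ ω) ∂P) (∫ ω, fderiv ℝ φ (Y t ω) (W t ω) ∂P) I t := by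
  obtain ⟨B, hB⟩ := hφc.exists_bound_of_continuous hφ.continuous
  obtain ⟨D, hD⟩ := (hφc.fderiv (𝕜 := ℝ)).exists_bound_of_continuous
    (hφ.continuous_fderiv one_ne_zero)
  obtain ⟨M, hM⟩ := hbound (tsupport φ) hφc
  have hmeas : ∀ τ ∈ I, AEStronglyMeasurable (fun ω => φ (Y τ ω)) P := fun τ hτ =>
    hφ.continuous.comp_aestronglyMeasurable (hY τ hτ).aestronglyMeasurable
  refine hasDerivWithinAt_integral_of_dominated
    (F' := fun τ ω => fderiv ℝ φ (Y τ ω) (W τ ω)) (bound := fun _ => |D * M|) hI hmeas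
    (integrable_const _) ?_ ?_ ht (Integrable.of_bound (hmeas t ht) B (ae_of_all _ fun ω => hB _))
  · filter_upwards [hflow] with ω hω τ hτ
    exact (hφ.differentiable one_ne_zero _).hasFDerivAt.comp_hasDerivWithinAt τ (hω τ hτ)
  · filter_upwards [hM] with ω hω τ hτ
    by_cases hmem : Y τ ω ∈ tsupport φ
    · exact ((fderiv ℝ φ (Y τ ω)).le_of_opNorm_le_of_le (hD _) (hω τ hτ hmem)).trans
        (le_abs_self _)
    · rw [image_eq_zero_of_notMem_tsupport fun h => hmem (tsupport_fderiv_subset ℝ h),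
        zero_apply, norm_zero]
      exact abs_nonneg _

end WeakContinuityEquation

section Entropy

variable {d : ℕ} {T : ℝ} {π : State d → ℝ} {f : ℝ → State d → ℝ} {t : ℝ}

lemma continuous_log_div {ρ : State d → ℝ} (hρ : Continuous ρ) (hπ : Continuous π)
    (hρ₀ : ∀ x, ρ x ≠ 0) (hπ₀ : ∀ x, π x ≠ 0) : Continuous fun x => Real.log (ρ x / π x) :=
  (hρ.div hπ hπ₀).log fun x => div_ne_zero (hρ₀ x) (hπ₀ x)

namespace RegularDensity

lemma contDiff_one (hf : RegularDensity T π f) (ht : t ∈ Icc 0 T) : ContDiff ℝ 1 (f t) :=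
  (contDiff_slice hf.contDiff ht).of_le one_le_two

lemma continuous_timeDeriv (hf : RegularDensity T π f) (hT : 0 < T) (ht : t ∈ Icc 0 T) :
    Continuous (timeDeriv (Icc 0 T) f t) :=
  SBTM.continuous_timeDeriv (uniqueDiffOn_Icc hT) (hf.contDiff.of_le one_le_two) ht

lemma hasDerivWithinAt (hf : RegularDensity T π f) (ht : t ∈ Icc 0 T) (x : State d) :
    HasDerivWithinAt (fun τ => f τ x) (timeDeriv (Icc 0 T) f t x) (Icc 0 T) t :=
  (hasDerivWithinAt_timeSlice (hf.contDiff.differentiableOn two_ne_zero (t, x)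
    ⟨ht, mem_univ x⟩)).differentiableWithinAt.hasDerivWithinAt

lemma hasDerivWithinAt_mul_log (hf : RegularDensity T π f) (ht : t ∈ Icc 0 T) {x : State d}
    (hπ : π x ≠ 0) :
    HasDerivWithinAt (fun τ => f τ x * Real.log (f τ x / π x))
      (timeDeriv (Icc 0 T) f t x * (Real.log (f t x / π x) + 1)) (Icc 0 T) t := by
  have hfx : f t x ≠ 0 := (hf.pos t ht x).ne'
  have hderiv := hf.hasDerivWithinAt ht x
  refine (hderiv.mul ((hderiv.div_const (π x)).log (div_ne_zero hfx hπ))).congr_deriv ?_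
  field_simp

lemma exists_integrable_bound (hf : RegularDensity T π f) :
    ∃ g : State d → ℝ, Integrable g ∧ ∀ t ∈ Icc 0 T, ∀ x,
      ‖timeDeriv (Icc 0 T) f t x‖ ≤ g x ∧
      ‖timeDeriv (Icc 0 T) f t x * Real.log (f t x / π x)‖ ≤ g x ∧
      ‖timeDeriv (Icc 0 T) f t x * (Real.log (f t x / π x) + 1)‖ ≤ g x := by
  obtain ⟨g, hg, hdom⟩ := hf.dominated
  refine ⟨g, hg, fun t ht x => ⟨?_, ?_, ?_⟩⟩ <;> refine le_trans ?_ (hdom t ht x)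
  · exact le_mul_of_one_le_right (abs_nonneg _) (le_add_of_nonneg_right (abs_nonneg _))
  · rw [norm_mul]
    exact mul_le_mul_of_nonneg_left (le_add_of_nonneg_left zero_le_one) (norm_nonneg _)
  · rw [norm_mul, add_comm]
    exact mul_le_mul_of_nonneg_left ((norm_add_le _ _).trans_eq (by rw [norm_one]; rfl))
      (norm_nonneg _)

lemma integrable_timeDeriv (hf : RegularDensity T π f) (hT : 0 < T) (ht : t ∈ Icc 0 T) :
    Integrable (timeDeriv (Icc 0 T) f t) := by
  obtain ⟨g, hg, hdom⟩ := hf.exists_integrable_bound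
  exact hg.mono' (hf.continuous_timeDeriv hT ht).aestronglyMeasurable
    (ae_of_all _ fun x => (hdom t ht x).1)

lemma integrable_timeDeriv_mul_log (hf : RegularDensity T π f) (hT : 0 < T)
    (hπ : Continuous π) (hπ₀ : ∀ x, π x ≠ 0) (ht : t ∈ Icc 0 T) :
    Integrable fun x => timeDeriv (Icc 0 T) f t x * Real.log (f t x / π x) := by
  obtain ⟨g, hg, hdom⟩ := hf.exists_integrable_bound
  have hlog := continuous_log_div (hf.contDiff_one ht).continuous hπ
    (fun x => (hf.pos t ht x).ne') hπ₀
  exact hg.mono' ((hf.continuous_timeDeriv hT ht).mul hlog).aestronglyMeasurable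
    (ae_of_all _ fun x => (hdom t ht x).2.1)

lemma hasDerivWithinAt_integral_mul (hf : RegularDensity T π f) (hint : Integrable (f t))
    {φ : State d → ℝ} (hφ : Continuous φ) {C : ℝ} (hC : ∀ x, ‖φ x‖ ≤ C) (ht : t ∈ Icc 0 T) :
    HasDerivWithinAt (fun τ => ∫ x, f τ x * φ x)
      (∫ x, timeDeriv (Icc 0 T) f t x * φ x) (Icc 0 T) t := by
  obtain ⟨g, hg, hdom⟩ := hf.exists_integrable_bound
  refine hasDerivWithinAt_integral_of_dominated
    (F' := fun τ x => timeDeriv (Icc 0 T) f τ x * φ x) (convex_Icc 0 T)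
    (fun τ hτ => ((hf.contDiff_one hτ).continuous.mul hφ).aestronglyMeasurable)
    (hg.mul_const C) (ae_of_all _ fun x τ hτ => (hf.hasDerivWithinAt hτ x).mul_const _)
    (ae_of_all _ fun x τ hτ => ?_) ht (hint.mul_bdd hφ.aestronglyMeasurable (ae_of_all _ hC))
  rw [norm_mul]
  exact mul_le_mul (hdom τ hτ x).1 (hC x) (norm_nonneg _) ((norm_nonneg _).trans (hdom τ hτ x).1)

lemma integral_timeDeriv_eq_zero (hf : RegularDensity T π f) (hT : 0 < T)
    (hone : ∀ t ∈ Icc 0 T, ∫ x, f t x = 1) (ht : t ∈ Icc 0 T) :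
    ∫ x, timeDeriv (Icc 0 T) f t x = 0 := by
  have hint : Integrable (f t) := .of_integral_ne_zero (hone t ht ▸ one_ne_zero)
  have hmass := hf.hasDerivWithinAt_integral_mul hint (continuous_const (y := (1 : ℝ)))
    (fun _ => le_rfl) ht
  simp only [mul_one] at hmass
  exact (uniqueDiffOn_Icc hT t ht).eq_deriv _ hmass
    ((hasDerivWithinAt_const t _ (1 : ℝ)).congr hone (hone t ht))

lemma integrable_mul_log (hf : RegularDensity T π f) (hπ : Continuous π) (hπ_pos : ∀ x, 0 < π x)
    (ht : t ∈ Icc 0 T) : Integrable fun x => f t x * Real.log (f t x / π x) := by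
  obtain ⟨g, hg, hdom⟩ := hf.exists_integrable_bound
  have hπ₀ : ∀ x, π x ≠ 0 := fun x => (hπ_pos x).ne'
  have h0 : (0 : ℝ) ∈ Icc 0 T := left_mem_Icc.2 (ht.1.trans ht.2)
  have hcont : ∀ τ ∈ Icc 0 T, Continuous (f τ) := fun τ hτ => (hf.contDiff_one hτ).continuous
  refine integrable_of_hasDerivWithinAt_of_dominated
    (F := fun τ x => f τ x * Real.log (f τ x / π x)) (convex_Icc 0 T)
    (fun τ hτ => ((hcont τ hτ).mul (continuous_log_div (hcont τ hτ) hπ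
      (fun x => (hf.pos τ hτ x).ne') hπ₀)).aestronglyMeasurable) hg
    (ae_of_all _ fun x τ hτ => hf.hasDerivWithinAt_mul_log hτ (hπ₀ x))
    (ae_of_all _ fun x τ hτ => (hdom τ hτ x).2.2) h0 ?_ ht
  exact (relEntropy_ne_top_iff (hcont 0 h0).measurable hπ.measurable
    (fun x => (hf.pos 0 h0 x).le) hπ_pos).1 hf.entropy_ne_top

theorem relEntropy_ne_top (hf : RegularDensity T π f) (hπ : Continuous π) (hπ_pos : ∀ x, 0 < π x)
    (ht : t ∈ Icc 0 T) : relEntropy (f t) π ≠ ⊤ :=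
  (relEntropy_ne_top_iff (hf.contDiff_one ht).continuous.measurable hπ.measurable
    (fun x => (hf.pos t ht x).le) hπ_pos).2 (hf.integrable_mul_log hπ hπ_pos ht)

theorem hasDerivWithinAt_relEntropy (hf : RegularDensity T π f) (hT : 0 < T) (hπ : Continuous π)
    (hπ_pos : ∀ x, 0 < π x) (hπ_one : ∫ x, π x = 1) (hone : ∀ t ∈ Icc 0 T, ∫ x, f t x = 1)
    (ht : t ∈ Icc 0 T) :
    HasDerivWithinAt (fun τ => (relEntropy (f τ) π).toReal)
      (∫ x, timeDeriv (Icc 0 T) f t x * Real.log (f t x / π x)) (Icc 0 T) t := by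
  obtain ⟨g, hg, hdom⟩ := hf.exists_integrable_bound
  have hπ₀ : ∀ x, π x ≠ 0 := fun x => (hπ_pos x).ne'
  have hint := fun τ hτ => hf.integrable_mul_log (t := τ) hπ hπ_pos hτ
  have hderiv := hasDerivWithinAt_integral_of_dominated (convex_Icc 0 T)
    (fun τ hτ => (hint τ hτ).1) hg
    (ae_of_all _ fun x τ hτ => hf.hasDerivWithinAt_mul_log hτ (hπ₀ x))
    (ae_of_all _ fun x τ hτ => (hdom τ hτ x).2.2) ht (hint t ht)
  have hentropy : ∀ τ ∈ Icc 0 T,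
      (relEntropy (f τ) π).toReal = ∫ x, f τ x * Real.log (f τ x / π x) := fun τ hτ =>
    toReal_relEntropy (hf.contDiff_one hτ).continuous.measurable hπ.measurable
      (fun x => (hf.pos τ hτ x).le) hπ_pos (hone τ hτ) hπ_one
  refine (hderiv.congr hentropy (hentropy t ht)).congr_deriv ?_
  simp only [mul_add, mul_one]
  rw [integral_add (hf.integrable_timeDeriv_mul_log hT hπ hπ₀ ht) (hf.integrable_timeDeriv hT ht),
    hf.integral_timeDeriv_eq_zero hT hone ht, add_zero]

end RegularDensity

end Entropy

section Dissipation

variable {Ω : Type*} [MeasurableSpace Ω] {P : Measure Ω} {d : ℕ} {T : ℝ} {π ρ : State d → ℝ}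
  {f : ℝ → State d → ℝ} {Y V : Ω → State d} {t : ℝ}

lemma fisherDensity_eq (hρ : ContDiff ℝ 1 ρ) (hπ : ContDiff ℝ 1 π) (hρ₀ : ∀ x, ρ x ≠ 0)
    (hπ₀ : ∀ x, π x ≠ 0) : fisherDensity ρ π = fun x => ‖score ρ x - score π x‖ ^ 2 := by
  ext x
  rw [fisherDensity, gradient_log_div (hρ.differentiable one_ne_zero x)
    (hπ.differentiable one_ne_zero x) (hρ₀ x) (hπ₀ x)]

lemma memLp_score_sub_score (hρ : ContDiff ℝ 1 ρ) (hπ : ContDiff ℝ 1 π) (hρ₀ : ∀ x, ρ x ≠ 0)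
    (hπ₀ : ∀ x, π x ≠ 0) (hlaw : HasLaw Y (densityMeasure ρ) P)
    (hfisher : Integrable (fisherDensity ρ π) (densityMeasure ρ)) :
    MemLp (fun ω => score ρ (Y ω) - score π (Y ω)) 2 P := by
  have hcont : Continuous fun x => score ρ x - score π x :=
    (continuous_score hρ hρ₀).sub (continuous_score hπ hπ₀)
  rw [memLp_two_iff_integrable_sq_norm
    (hcont.comp_aestronglyMeasurable hlaw.aemeasurable.aestronglyMeasurable)]
  rw [fisherDensity_eq hρ hπ hρ₀ hπ₀, ← hlaw.map_eq] at hfisher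
  exact hfisher.comp_aemeasurable hlaw.aemeasurable

lemma integral_norm_score_sub_score_sq (hρ : ContDiff ℝ 1 ρ) (hπ : ContDiff ℝ 1 π)
    (hρ₀ : ∀ x, ρ x ≠ 0) (hπ₀ : ∀ x, π x ≠ 0) (hlaw : HasLaw Y (densityMeasure ρ) P) :
    ∫ ω, ‖score ρ (Y ω) - score π (Y ω)‖ ^ 2 ∂P = fisherInfo ρ π := by
  have hcont : Continuous fun x => ‖score ρ x - score π x‖ ^ 2 :=
    ((continuous_score hρ hρ₀).sub (continuous_score hπ hπ₀)).norm.pow 2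
  rw [fisherInfo, fisherDensity_eq hρ hπ hρ₀ hπ₀,
    ← hlaw.integral_comp hcont.aestronglyMeasurable]
  rfl

lemma inner_neg_sub_le {F : Type*} [NormedAddCommGroup F] [InnerProductSpace ℝ F] (u r : F) :
    inner ℝ u (-u - r) ≤ -(1 / 2) * ‖u‖ ^ 2 + 1 / 2 * ‖r‖ ^ 2 := by
  have hsq := norm_add_sq_real u r
  rw [inner_sub_right, inner_neg_right, real_inner_self_eq_norm_sq]
  linarith [sq_nonneg ‖u + r‖]

theorem WeakContinuityEq.integral_mul_log_div_le [IsFiniteMeasure P] {m : State d → ℝ}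
    (h : WeakContinuityEq volume m P Y fun ω => score π (Y ω) - V ω)
    (hρ : ContDiff ℝ 1 ρ) (hπ : ContDiff ℝ 1 π) (hρ₀ : ∀ x, ρ x ≠ 0) (hπ₀ : ∀ x, π x ≠ 0)
    (hlaw : HasLaw Y (densityMeasure ρ) P) (hm : AEStronglyMeasurable m volume)
    (hmlog : Integrable fun x => m x * Real.log (ρ x / π x))
    (hfisher : Integrable (fisherDensity ρ π) (densityMeasure ρ))
    (hV : MemLp (fun ω => V ω - score ρ (Y ω)) 2 P) :
    ∫ x, m x * Real.log (ρ x / π x)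
      ≤ -(1 / 2) * fisherInfo ρ π + 1 / 2 * ∫ ω, ‖V ω - score ρ (Y ω)‖ ^ 2 ∂P := by
  let φ : State d → ℝ := fun x => Real.log (ρ x / π x)
  have hφ : ContDiff ℝ 1 φ := (hρ.div hπ hπ₀).log fun x => div_ne_zero (hρ₀ x) (hπ₀ x)
  have hgrad (x : State d) : gradient φ x = score ρ x - score π x :=
    gradient_log_div (hρ.differentiable one_ne_zero x) (hπ.differentiable one_ne_zero x)
      (hρ₀ x) (hπ₀ x)
  have hfderiv (x v : State d) : fderiv ℝ φ x v = inner ℝ (score ρ x - score π x) v := by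
    rw [← hgrad, gradient, InnerProductSpace.toDual_symm_apply]
  have hnorm (x : State d) : ‖fderiv ℝ φ x‖ = ‖score ρ x - score π x‖ := by
    rw [← hgrad, gradient, LinearIsometryEquiv.norm_map]
  have hu : MemLp (fun ω => score ρ (Y ω) - score π (Y ω)) 2 P :=
    memLp_score_sub_score hρ hπ hρ₀ hπ₀ hlaw hfisher
  have hvel (ω : Ω) : score π (Y ω) - V ω
      = -(score ρ (Y ω) - score π (Y ω)) - (V ω - score ρ (Y ω)) := by abel
  have hW : MemLp (fun ω => score π (Y ω) - V ω) 2 P := by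
    simp only [hvel]
    exact hu.neg.sub hV
  have hφW : Integrable (fun ω => ‖fderiv ℝ φ (Y ω)‖ * ‖score π (Y ω) - V ω‖) P := by
    simp only [hnorm]
    exact hu.norm.integrable_mul hW.norm
  rw [h.integral_mul_eq hφ hm hmlog hlaw.aemeasurable (hW.integrable one_le_two) hφW,
    ← integral_norm_score_sub_score_sq hρ hπ hρ₀ hπ₀ hlaw, ← integral_const_mul,
    ← integral_const_mul, ← integral_add (hu.norm.integrable_sq.const_mul _)
      (hV.norm.integrable_sq.const_mul _)]
  refine integral_mono (hφW.mono' (aestronglyMeasurable_fderiv_apply hφ hlaw.aemeasurable hW.1)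
      (ae_of_all _ fun ω => (fderiv ℝ φ (Y ω)).le_opNorm _))
    ((hu.norm.integrable_sq.const_mul _).add (hV.norm.integrable_sq.const_mul _)) fun ω => ?_
  simp only [hfderiv, hvel]
  exact inner_neg_sub_le _ _

variable [IsProbabilityMeasure P]

lemma integral_eq_one_of_hasLaw (hρ : Measurable ρ) (hρ₀ : ∀ x, 0 ≤ ρ x)
    (hlaw : HasLaw Y (densityMeasure ρ) P) : ∫ x, ρ x = 1 :=
  (isProbabilityMeasure_densityMeasure_iff hρ hρ₀).1 (hlaw.isProbabilityMeasure_iff.1 inferInstance)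

theorem RegularDensity.weakContinuityEq (hf : RegularDensity T π f) (hT : 0 < T)
    {Y W : ℝ → Ω → State d} (hlaw : ∀ τ ∈ Icc 0 T, HasLaw (Y τ) (densityMeasure (f τ)) P)
    (hflow : ∀ᵐ ω ∂P, ∀ τ ∈ Icc 0 T, HasDerivWithinAt (fun τ => Y τ ω) (W τ ω) (Icc 0 T) τ)
    (hbound : ∀ K, IsCompact K → ∃ M, ∀ᵐ ω ∂P, ∀ τ ∈ Icc 0 T, Y τ ω ∈ K → ‖W τ ω‖ ≤ M)
    (ht : t ∈ Icc 0 T) : WeakContinuityEq volume (timeDeriv (Icc 0 T) f t) P (Y t) (W t) := by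
  intro φ hφ hφc
  have hmeas : ∀ τ ∈ Icc 0 T, Measurable (f τ) := fun τ hτ =>
    (hf.contDiff_one hτ).continuous.measurable
  have hnonneg : ∀ τ ∈ Icc 0 T, ∀ x, 0 ≤ f τ x := fun τ hτ x => (hf.pos τ hτ x).le
  have hint : Integrable (f t) := .of_integral_ne_zero <|
    (integral_eq_one_of_hasLaw (hmeas t ht) (hnonneg t ht) (hlaw t ht)).trans_ne one_ne_zero
  obtain ⟨C, hC⟩ := hφc.exists_bound_of_continuous hφ.continuous
  have hdensity := hf.hasDerivWithinAt_integral_mul hint hφ.continuous hC ht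
  have hparticle := hasDerivWithinAt_integral_testFunction (convex_Icc 0 T)
    (fun τ hτ => (hlaw τ hτ).aemeasurable) hflow hbound hφ hφc ht
  have heq : ∀ τ ∈ Icc 0 T, ∫ x, f τ x * φ x = ∫ ω, φ (Y τ ω) ∂P := fun τ hτ => by
    rw [← integral_densityMeasure (hmeas τ hτ) (hnonneg τ hτ)]
    exact ((hlaw τ hτ).integral_comp hφ.continuous.aestronglyMeasurable).symm
  exact (uniqueDiffOn_Icc hT t ht).eq_deriv _ hdensity (hparticle.congr heq (heq t ht))

lemma RegularDensity.exists_norm_score_sub_le (hf : RegularDensity T π f) (hT : 0 < T)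
    (hπ : ContDiff ℝ 1 π) (hπ₀ : ∀ x, π x ≠ 0) {K : Set (State d)} (hK : IsCompact K) :
    ∃ M, ∀ t ∈ Icc 0 T, ∀ x ∈ K, ‖score π x - score (f t) x‖ ≤ M := by
  have hcont : ContinuousOn (fun p : ℝ × State d => score π p.2 - score (f p.1) p.2)
      (Icc 0 T ×ˢ K) :=
    (((continuous_score hπ hπ₀).comp continuous_snd).continuousOn).sub
      ((differentiableOn_score (uniqueDiffOn_Icc hT) hf.contDiff
        fun t ht x => (hf.pos t ht x).ne').continuousOn.mono (prod_mono_right (subset_univ K)))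
  obtain ⟨M, hM⟩ := (isCompact_Icc.prod hK).exists_bound_of_continuousOn hcont
  exact ⟨M, fun t ht x hx => hM (t, x) ⟨ht, hx⟩⟩

theorem RegularDensity.integral_timeDeriv_mul_log_le (hf : RegularDensity T π f) (hT : 0 < T)
    (hπ : ContDiff ℝ 1 π) (hπ₀ : ∀ x, π x ≠ 0) {Y V : ℝ → Ω → State d} {B : ℝ}
    (hlaw : ∀ τ ∈ Icc 0 T, HasLaw (Y τ) (densityMeasure (f τ)) P)
    (hflow : ∀ᵐ ω ∂P, ∀ τ ∈ Icc 0 T,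
      HasDerivWithinAt (fun τ => Y τ ω) (score π (Y τ ω) - V τ ω) (Icc 0 T) τ)
    (hB : ∀ᵐ ω ∂P, ∀ τ ∈ Icc 0 T, ‖V τ ω - score (f τ) (Y τ ω)‖ ≤ B)
    (ht : t ∈ Icc 0 T) (hV : MemLp (fun ω => V t ω - score (f t) (Y t ω)) 2 P) :
    ∫ x, timeDeriv (Icc 0 T) f t x * Real.log (f t x / π x)
      ≤ -(1 / 2) * fisherInfo (f t) π
        + 1 / 2 * ∫ ω, ‖V t ω - score (f t) (Y t ω)‖ ^ 2 ∂P := by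
  have hbound : ∀ K, IsCompact K →
      ∃ M, ∀ᵐ ω ∂P, ∀ τ ∈ Icc 0 T, Y τ ω ∈ K → ‖score π (Y τ ω) - V τ ω‖ ≤ M := fun K hK => by
    obtain ⟨M, hM⟩ := hf.exists_norm_score_sub_le hT hπ hπ₀ hK
    refine ⟨M + B, ?_⟩
    filter_upwards [hB] with ω hω τ hτ hmem
    rw [← sub_sub_sub_cancel_right _ _ (score (f τ) (Y τ ω))]
    exact norm_sub_le_of_le (hM τ hτ _ hmem) (hω τ hτ)
  exact (hf.weakContinuityEq hT hlaw hflow hbound ht).integral_mul_log_div_le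
    (hf.contDiff_one ht) hπ (fun x => (hf.pos t ht x).ne') hπ₀ (hlaw t ht)
    (hf.continuous_timeDeriv hT ht).aestronglyMeasurable
    (hf.integrable_timeDeriv_mul_log hT hπ.continuous hπ₀ ht) (hf.fisher t ht) hV

theorem RegularDensity.integral_timeDeriv_mul_log_le_of_empiricalLoss_le {n : ℕ} (hn : 0 < n)
    (hf : RegularDensity T π f) (hT : 0 < T) (hπ : ContDiff ℝ 1 π) (hπ₀ : ∀ x, π x ≠ 0)
    {X : Fin n → ℝ → Ω → State d} {σ : ℝ → Ω → State d → State d} {δ : ℝ}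
    (hlaw : ∀ i, ∀ τ ∈ Icc 0 T, HasLaw (X i τ) (densityMeasure (f τ)) P)
    (hflow : ∀ᵐ ω ∂P, ∀ τ ∈ Icc 0 T, ∀ i,
      HasDerivWithinAt (fun τ => X i τ ω) (score π (X i τ ω) - σ τ ω (X i τ ω)) (Icc 0 T) τ)
    (hloss : ∀ᵐ ω ∂P, ∀ τ ∈ Icc 0 T, empiricalLoss (σ τ ω) (f τ) (fun i => X i τ ω) ≤ δ)
    (ht : t ∈ Icc 0 T) (hσ : ∀ i, AEStronglyMeasurable (fun ω => σ t ω (X i t ω)) P) :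
    ∫ x, timeDeriv (Icc 0 T) f t x * Real.log (f t x / π x)
      ≤ -(1 / 2) * fisherInfo (f t) π + 1 / 2 * δ := by
  have hn' : (0 : ℝ) < n := Nat.cast_pos.2 hn
  let r (i : Fin n) (τ : ℝ) (ω : Ω) : State d := σ τ ω (X i τ ω) - score (f τ) (X i τ ω)
  have hr (i : Fin n) : ∀ᵐ ω ∂P, ∀ τ ∈ Icc 0 T, ‖r i τ ω‖ ≤ √(n * δ) := by
    filter_upwards [hloss] with ω hω τ hτ
    exact Real.le_sqrt_of_sq_le ((norm_sq_le_empiricalLoss _ _ (fun i => X i τ ω) i).trans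
      (mul_le_mul_of_nonneg_left (hω τ hτ) hn'.le))
  have hrLp (i : Fin n) : MemLp (r i t) 2 P :=
    .of_bound ((hσ i).sub ((continuous_score (hf.contDiff_one ht) fun x => (hf.pos t ht x).ne')
      |>.comp_aestronglyMeasurable (hlaw i t ht).aemeasurable.aestronglyMeasurable)) _
      ((hr i).mono fun ω hω => hω t ht)
  have hsum : ∑ i, ∫ ω, ‖r i t ω‖ ^ 2 ∂P ≤ ∑ _i : Fin n, δ := by
    rw [← integral_finsetSum _ fun i _ => (hrLp i).norm.integrable_sq, Fin.sum_const, nsmul_eq_mul]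
    refine (integral_mono_ae (integrable_finsetSum _ fun i _ => (hrLp i).norm.integrable_sq)
      (integrable_const (n * δ)) ?_).trans_eq
        (by simp only [integral_const, probReal_univ, one_smul])
    filter_upwards [hloss] with ω hω
    exact (inv_mul_le_iff₀ hn').1 (hω t ht)
  obtain ⟨i, -, hi⟩ := Finset.exists_le_of_sum_le ⟨⟨0, hn⟩, Finset.mem_univ _⟩ hsum
  have hdissipation := hf.integral_timeDeriv_mul_log_le hT hπ hπ₀ (hlaw i)
    (hflow.mono fun ω hω τ hτ => hω τ hτ i) (hr i) ht (hrLp i)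
  linarith [hdissipation, hi]

end Dissipation

section Decay

lemma SufficientTraining.ae_antitoneOn_empiricalLoss {Ω : Type*} [MeasurableSpace Ω] {P : Measure Ω}
    {d n N : ℕ} (hn : 0 < n) {T : ℝ} (hT : 0 < T) {π : State d → ℝ}
    {s : Weights N → State d → State d}
    (hs : Differentiable ℝ fun p : Weights N × State d => s p.1 p.2)
    {η lam : ℝ → Ω → ℝ} {f : ℝ → State d → ℝ} {X : Fin n → ℝ → Ω → State d}
    {Θ : ℝ → Ω → Weights N} (htrain : SufficientTraining P T s η lam f X Θ)
    (hf : RegularDensity T π f)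
    (hX : ∀ᵐ ω ∂P, ∀ i, DifferentiableOn ℝ (fun τ => X i τ ω) (Icc 0 T))
    (hΘ : ∀ᵐ ω ∂P, ∀ t ∈ Icc 0 T, HasDerivWithinAt (fun τ => Θ τ ω)
      (-(η t ω) • gradient (fun θ => empiricalLoss (s θ) (f t) fun i => X i t ω) (Θ t ω))
      (Icc 0 T) t) :
    ∀ᵐ ω ∂P, AntitoneOn (fun t => empiricalLoss (s (Θ t ω)) (f t) fun i => X i t ω)
      (Icc 0 T) := by
  have : (0 : ℝ) < n := Nat.cast_pos.2 hn
  filter_upwards [htrain, hX, hΘ] with ω htrain hX hΘ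
  refine antitoneOn_empiricalLoss (lam := fun t => lam t ω) (convex_Icc 0 T) hs
    (differentiableOn_score (uniqueDiffOn_Icc hT) hf.contDiff fun t ht x => (hf.pos t ht x).ne')
    hX hΘ (fun t ht => (htrain t ht).2.2.1) (fun t ht => (htrain t ht).2.1) fun t ht hloss => ?_
  obtain ⟨hlam, -, hη, hrate⟩ := htrain t ht
  calc derivWithin (fun τ =>
        Real.log (empiricalLoss (s (Θ t ω)) (f τ) fun i => X i τ ω)) (Icc 0 T) t
      = lam t ω / n * (n / lam t ω * derivWithin (fun τ =>
          Real.log (empiricalLoss (s (Θ t ω)) (f τ) fun i => X i τ ω)) (Icc 0 T) t) := by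
        field_simp
    _ ≤ lam t ω / n * η t ω := mul_le_mul_of_nonneg_left (hrate hloss) (by positivity)
    _ ≤ 4 * lam t ω / n * η t ω := by
        gcongr
        linarith

lemma LogSobolev.relEntropy_le_mul_exp {d : ℕ} {T α : ℝ} {π : State d → ℝ} {f : ℝ → State d → ℝ}
    {u' : ℝ → ℝ} (hα : 0 < α) (hLS : LogSobolev π α) (hf : RegularDensity T π f)
    (hone : ∀ t ∈ Icc 0 T, ∫ x, f t x = 1) (hfin : ∀ t ∈ Icc 0 T, relEntropy (f t) π ≠ ⊤)
    (hu : ∀ t ∈ Icc 0 T,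
      HasDerivWithinAt (fun τ => (relEntropy (f τ) π).toReal) (u' t) (Icc 0 T) t)
    (hle : ∀ t ∈ Icc 0 T, u' t ≤ -(1 / 4 * fisherInfo (f t) π)) {t : ℝ} (ht : t ∈ Icc 0 T) :
    relEntropy (f t) π
      ≤ relEntropy (f 0) π * ENNReal.ofReal (Real.exp (-(1 / (4 * α)) * t)) := by
  have hdecay : ∀ τ ∈ Icc 0 T, u' τ ≤ -(1 / (4 * α)) * (relEntropy (f τ) π).toReal := by
    intro τ hτ
    have hKL := ENNReal.toReal_le_of_le_ofReal (mul_nonneg hα.le (fisherInfo_nonneg (f τ) π))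
      (hLS (f τ) (hf.contDiff_one hτ) (hf.pos τ hτ) (hone τ hτ) (hf.fisher τ hτ))
    calc u' τ ≤ -(1 / 4 * fisherInfo (f τ) π) := hle τ hτ
      _ = -(1 / (4 * α)) * (α * fisherInfo (f τ) π) := by field_simp
      _ ≤ -(1 / (4 * α)) * (relEntropy (f τ) π).toReal :=
        mul_le_mul_of_nonpos_left hKL (neg_nonpos.2 (by positivity))
  have hgronwall := le_mul_exp_of_hasDerivWithinAt_le hu hdecay ht
  rw [sub_zero] at hgronwall
  rw [← ENNReal.ofReal_toReal (hfin t ht), ← ENNReal.ofReal_toReal hf.entropy_ne_top,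
    ← ENNReal.ofReal_mul ENNReal.toReal_nonneg]
  exact ENNReal.ofReal_le_ofReal hgronwall

end Decay

end SBTM

theorem mainTheorem1_general {Ω : Type*} [MeasurableSpace Ω] (P : Measure Ω)
    [IsProbabilityMeasure P] {d n N : ℕ} (hn : 0 < n) (T : ℝ) (hT : 0 < T)
    (π : State d → ℝ) (hπ_diff : ContDiff ℝ 1 π) (hπ_pos : ∀ x, 0 < π x) (hπ_one : ∫ x, π x = 1)
    (s : Weights N → State d → State d)
    (hs : Differentiable ℝ (fun p : Weights N × State d => s p.1 p.2))
    (η lam : ℝ → Ω → ℝ) (f : ℝ → State d → ℝ)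
    (X : Fin n → ℝ → Ω → State d) (Θ : ℝ → Ω → Weights N)
    (hf : RegularDensity T π f)
    (hlaw : ∀ i, ∀ t ∈ Icc 0 T, HasLaw (X i t) (densityMeasure (f t)) P)
    (hΘ_meas : ∀ t ∈ Icc 0 T, AEMeasurable (Θ t) P)
    (hX : ∀ᵐ ω ∂P, ∀ t ∈ Icc 0 T, ∀ i, HasDerivWithinAt (fun τ => X i τ ω)
      (score π (X i t ω) - s (Θ t ω) (X i t ω)) (Icc 0 T) t)
    (hΘ : ∀ᵐ ω ∂P, ∀ t ∈ Icc 0 T, HasDerivWithinAt (fun τ => Θ τ ω)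
      (-(η t ω) • gradient (fun θ => empiricalLoss (s θ) (f t) (fun i => X i t ω)) (Θ t ω))
      (Icc 0 T) t)
    (htrain : SufficientTraining P T s η lam f X Θ)
    (ε : ℝ) (hε : ε = ⨅ t : Icc (0 : ℝ) T, fisherInfo (f t) π)
    (hinit : ∀ᵐ ω ∂P, empiricalLoss (s (Θ 0 ω)) (f 0) (fun i => X i 0 ω) ≤ ε / 2) :
    (∀ t ∈ Icc 0 T,
      relEntropy (f t) π ≠ ⊤ ∧
      DifferentiableWithinAt ℝ (fun τ => (relEntropy (f τ) π).toReal) (Icc 0 T) t ∧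
      1 / 4 * fisherInfo (f t) π
        ≤ -derivWithin (fun τ => (relEntropy (f τ) π).toReal) (Icc 0 T) t) ∧
    (∀ α : ℝ, 0 < α → LogSobolev π α → ∀ t ∈ Icc 0 T,
      relEntropy (f t) π
        ≤ relEntropy (f 0) π * ENNReal.ofReal (Real.exp (-(1 / (4 * α)) * t))) := by
  have hloss : ∀ᵐ ω ∂P, ∀ t ∈ Icc 0 T,
      empiricalLoss (s (Θ t ω)) (f t) (fun i => X i t ω) ≤ ε / 2 := by
    filter_upwards [hinit, htrain.ae_antitoneOn_empiricalLoss hn hT hs hf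
      (hX.mono fun ω h i t ht => (h t ht i).differentiableWithinAt) hΘ] with ω h₀ hanti t ht
    exact (hanti (left_mem_Icc.2 hT.le) ht ht.1).trans h₀
  have hone : ∀ t ∈ Icc 0 T, ∫ x, f t x = 1 := fun t ht =>
    integral_eq_one_of_hasLaw (hf.contDiff_one ht).continuous.measurable
      (fun x => (hf.pos t ht x).le) (hlaw ⟨0, hn⟩ t ht)
  have hfin := fun t ht => hf.relEntropy_ne_top (t := t) hπ_diff.continuous hπ_pos ht
  have hderiv := fun t ht =>
    hf.hasDerivWithinAt_relEntropy (t := t) hT hπ_diff.continuous hπ_pos hπ_one hone ht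
  have hdissipation : ∀ t ∈ Icc 0 T, ∫ x, timeDeriv (Icc 0 T) f t x * Real.log (f t x / π x)
      ≤ -(1 / 4 * fisherInfo (f t) π) := fun t ht => by
    have hle := hf.integral_timeDeriv_mul_log_le_of_empiricalLoss_le hn hT hπ_diff
      (fun x => (hπ_pos x).ne') hlaw hX hloss ht fun i => hs.continuous.comp_aestronglyMeasurable
        ((hΘ_meas t ht).prodMk (hlaw i t ht).aemeasurable).aestronglyMeasurable
    have hε_le : ε ≤ fisherInfo (f t) π := hε.trans_le <|
      ciInf_le ⟨0, forall_mem_range.2 fun _ => fisherInfo_nonneg _ _⟩ (⟨t, ht⟩ : Icc (0 : ℝ) T)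
    linarith
  refine ⟨fun t ht => ⟨hfin t ht, (hderiv t ht).differentiableWithinAt, ?_⟩,
    fun α hα hLS t ht => hLS.relEntropy_le_mul_exp hα hf hone hfin hderiv hdissipation ht⟩
  rw [(hderiv t ht).derivWithin (uniqueDiffOn_Icc hT t ht)]
  exact le_neg_of_le_neg (hdissipation t ht)

theorem mainTheorem1 {Ω : Type*} [MeasurableSpace Ω] (P : Measure Ω) [IsProbabilityMeasure P]
    {d n N : ℕ} (hn : 0 < n) (T : ℝ) (hT : 0 < T)
    -- the target density
    (π : State d → ℝ) (hπ_diff : ContDiff ℝ 1 π) (hπ_pos : ∀ x, 0 < π x) (hπ_one : ∫ x, π x = 1)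
    -- the network
    (s : Weights N → State d → State d)
    (hs : Differentiable ℝ (fun p : Weights N × State d => s p.1 p.2))
    -- the dynamics
    (η lam : ℝ → Ω → ℝ) (f : ℝ → State d → ℝ)
    (X : Fin n → ℝ → Ω → State d) (Θ : ℝ → Ω → Weights N)
    (hf : RegularDensity T π f)
    (hdyn : Dynamics P T π s η f X Θ)
    (htrain : SufficientTraining P T s η lam f X Θ)
    (ε : ℝ) (hε : ε = ⨅ t : Icc (0 : ℝ) T, fisherInfo (f t) π)
    -- the initial training loss is small
    (hinit : ∀ᵐ ω ∂P, empiricalLoss (s (Θ 0 ω)) (f 0) (fun i => X i 0 ω) ≤ ε / 4)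
    -- the true loss is finite and well approximated by the training loss
    (happrox : ∀ᵐ ω ∂P, ∀ t ∈ Icc 0 T,
      Integrable (fun x => ‖s (Θ t ω) x - score (f t) x‖ ^ 2) (densityMeasure (f t)) ∧
      |empiricalLoss (s (Θ t ω)) (f t) (fun i => X i t ω) - trueLoss (s (Θ t ω)) (f t)| ≤ ε / 4) :
    (∀ t ∈ Icc 0 T,
      relEntropy (f t) π ≠ ⊤ ∧
      DifferentiableWithinAt ℝ (fun τ => (relEntropy (f τ) π).toReal) (Icc 0 T) t ∧
      1 / 4 * fisherInfo (f t) π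
        ≤ -derivWithin (fun τ => (relEntropy (f τ) π).toReal) (Icc 0 T) t) ∧
    (∀ α : ℝ, 0 < α → LogSobolev π α → ∀ t ∈ Icc 0 T,
      relEntropy (f t) π
        ≤ relEntropy (f 0) π * ENNReal.ofReal (Real.exp (-(1 / (4 * α)) * t))) := by
  have hε₀ : 0 ≤ ε := hε ▸ Real.iInf_nonneg fun _ => fisherInfo_nonneg _ _
  exact mainTheorem1_general P hn T hT π hπ_diff hπ_pos hπ_one s hs η lam f X Θ hf hdyn.law
    hdyn.weights hdyn.particle_flow hdyn.weight_flow htrain ε hε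
    (hinit.mono fun _ h => h.trans (by linarith))
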